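/- Let $\mathsf k$ be a field. Throughout, a graded module means a $\mathbb Z$-graded $\mathsf k$-vector space $V=\bigoplus_{d\in\mathbb Z}V_d$ together with a $\mathsf k$-linear endomorphism $f$ of degree one, $f(V_d)\subseteq V_{d+1}$. A string of length $i\ge 1$ beginning in degree $d$ is a sequence $g, f(g),\dots ,f^{i-1}(g)$ with $g\in V_d$ and $f^{i}(g)=0$. A Jordan degree type of $(V,f)$ is the finite multiset of symbols $i_d$ (one for each string of length $i$ beginning in degree $d$) arising from a decomposition of $V$ into strings, that is, from finitely many strings that together form a $\mathsf k$-basis of $V$. Write $m_s$ for a graded module whose Jordan degree type is the single string of length $m$ beginning in degree $s$. **Corollary 3.8.** Let $1\le m\le n$ be integers. Assume that $\operatorname{char}\mathsf k=0$ or $\operatorname{char}\mathsf k\ge m+n-2$, and that $\operatorname{char}\mathsf k\neq m+n-2$ if $m\ge 2$. Let $s,t\in\mathbb Z$, let $(V,x)$ be a graded module of type $m_s$ and $(W,y)$ a graded module of type $n_t$, and let $a,b\in\mathsf k$ be nonzero. Give $V\otimes_{\mathsf k} W$ the total grading $(V\otimes W)_d=\sum_{i+j=d}V_i\otimes W_j$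 and the endomorphism $\ell=a\,(x\otimes 1)+b\,(1\otimes y)$. Then $V\otimes_{\mathsf k} W$ is a graded module which has a Jordan degree type, this type is unique, and it is $$m_s\otimes n_t=\bigl((n+m-1)_{s+t},\,(n+m-3)_{s+t+1},\,\dots,\,(n-m+1)_{s+t+m-1}\bigr)=\bigoplus_{k=1}^{m}(n+m+1-2k)_{s+t+k-1}.$$ -/

import Mathlib

open scoped TensorProduct

/-- `𝒱` is a `ℤ`-grading of the `k`-vector space `V` (that is, `V = ⨁ d, 𝒱 d`) and the
endomorphism `f` is homogeneous of degree one. Such a pair is the same thing as a graded module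
over `k[t]`, where `t` has degree one and acts as `f`. -/
structure IsGradedEnd {k V : Type*} [Field k] [AddCommGroup V] [Module k V]
    (𝒱 : ℤ → Submodule k V) (f : Module.End k V) : Prop where
  isInternal : DirectSum.IsInternal 𝒱
  map_mem : ∀ (d : ℤ) (v : V), v ∈ 𝒱 d → f v ∈ 𝒱 (d + 1)

/-- The finitely many homogeneous vectors `g i`, of degree `deg i`, generate strings
`g i, f (g i), …, f ^ (len i - 1) (g i)` with `f ^ (len i) (g i) = 0`, which together form a basis
of `V`. So `V` is the direct sum of the cyclic `k[t]`-submodules generated by the `g i`, and the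
`i`-th of them has dimension `len i > 0` and begins in degree `deg i`. -/
structure IsStringDecomposition {k V : Type*} [Field k] [AddCommGroup V] [Module k V]
    (𝒱 : ℤ → Submodule k V) (f : Module.End k V)
    {r : ℕ} (len : Fin r → ℕ) (deg : Fin r → ℤ) (g : Fin r → V) : Prop where
  len_pos : ∀ i, 0 < len i
  mem_deg : ∀ i, g i ∈ 𝒱 (deg i)
  pow_len : ∀ i, (f ^ len i) (g i) = 0
  linearIndependent :
    LinearIndependent k (fun x : (Σ i : Fin r, Fin (len i)) => (f ^ (x.2 : ℕ)) (g x.1))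
  span_eq_top :
    Submodule.span k
      (Set.range (fun x : (Σ i : Fin r, Fin (len i)) => (f ^ (x.2 : ℕ)) (g x.1))) = ⊤

/-- `P` is a Jordan degree type of the graded vector space `(V, 𝒱)` with its degree-one
endomorphism `f`: the multiset of the pairs `(length, initial degree)` of the strings in some
decomposition of `V` into homogeneous strings of `f`. The pair `(i, d)` stands for `i_d`, a string
of length `i` beginning in degree `d`. -/
def HasJordanDegreeType {k V : Type*} [Field k] [AddCommGroup V] [Module k V]
    (𝒱 : ℤ → Submodule k V) (f : Module.End k V) (P : Multiset (ℕ × ℤ)) : Prop :=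
  IsGradedEnd 𝒱 f ∧
    ∃ (r : ℕ) (len : Fin r → ℕ) (deg : Fin r → ℤ) (g : Fin r → V),
      IsStringDecomposition 𝒱 f len deg g ∧
        P = (Finset.univ : Finset (Fin r)).val.map (fun i => (len i, deg i))

/-- The total grading of a tensor product: the degree `d` part of `V ⊗ W` is spanned by the
`v ⊗ w` with `v`, `w` homogeneous of degrees adding up to `d`. -/
def tensorGrading {k V W : Type*} [Field k] [AddCommGroup V] [Module k V]
    [AddCommGroup W] [Module k W] (𝒱 : ℤ → Submodule k V) (𝒲 : ℤ → Submodule k W) :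
    ℤ → Submodule k (V ⊗[k] W) :=
  fun d => Submodule.span k
    {u | ∃ (i j : ℤ) (v : V) (w : W), i + j = d ∧ v ∈ 𝒱 i ∧ w ∈ 𝒲 j ∧ v ⊗ₜ[k] w = u}

/-- The endomorphism `a (f ⊗ 1) + b (1 ⊗ g)` of `V ⊗ W`. -/
noncomputable def tensorEnd {k V W : Type*} [Field k] [AddCommGroup V] [Module k V]
    [AddCommGroup W] [Module k W] (a b : k) (f : Module.End k V) (g : Module.End k W) :
    Module.End k (V ⊗[k] W) :=
  a • TensorProduct.map f LinearMap.id + b • TensorProduct.map LinearMap.id g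

/-! ### Gradings and homogeneous bases -/

section Grading

variable {k U ι : Type*} [Field k] [AddCommGroup U] [Module k U]

/-! After `a`, `b` are absorbed into `x`, `y`, the two strings behave like irreducible `sl₂`-modules
with raising operators `x`, `y`, and `E = x ⊗ 1 + 1 ⊗ y` raises on the tensor product.
`exists_lowering` supplies lowering operators; the resulting `F` on the tensor product makes `FE -
EF` the scalar `n + m - 2 - 2d` in degree `s + t + d`.

For each `i < m` an explicit nonzero `g` in degree `s + t + i` satisfies `F g = 0`, hence `F
(E^(j+1) g) = (j+1)(μ - j) E^j g` with `μ = n + m - 2 - 2i`. If `E^l g` is the last nonzero vector,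
then `(l+1)(μ - l) = 0` in `k`; since `1, …, n + m - 2` are invertible when `m ≥ 2`, this forces `l
= μ` (`exists_generator_tensor`). The ends of these strings lie in distinct degrees, so the strings
are independent, and their lengths sum to `m * n`.

Uniqueness: the ranks of `f ^ j` on the graded pieces determine the number of strings of each kind.
-/

theorem isInternal_span_basis (b : Module.Basis ι k U) (deg : ι → ℤ) :
    DirectSum.IsInternal (fun d => Submodule.span k (b '' {i | deg i = d})) := by
  rw [DirectSum.isInternal_submodule_iff_iSupIndep_and_iSup_eq_top]
  constructor
  · intro d
    refine (b.linearIndependent.disjoint_span_image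
      (s := {i | deg i = d}) (t := {i | deg i ≠ d}) ?_).mono_right ?_
    · exact Set.disjoint_left.2 fun i hi hi' => hi' hi
    · refine iSup₂_le fun e he => Submodule.span_mono (Set.image_mono ?_)
      rintro i rfl
      exact he
  · rw [eq_top_iff, ← b.span_eq, Submodule.span_le]
    rintro _ ⟨i, rfl⟩
    exact Submodule.mem_iSup_of_mem (deg i) (Submodule.subset_span ⟨i, rfl, rfl⟩)

theorem eq_span_of_isInternal {𝒰 : ℤ → Submodule k U} (h : DirectSum.IsInternal 𝒰)
    (b : Module.Basis ι k U) {deg : ι → ℤ} (hb : ∀ i, b i ∈ 𝒰 (deg i)) (d : ℤ) :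
    𝒰 d = Submodule.span k (b '' {i | deg i = d}) := by
  have hle : Submodule.span k (b '' {i | deg i = d}) ≤ 𝒰 d := by
    rw [Submodule.span_le]
    rintro _ ⟨i, rfl, rfl⟩
    exact hb i
  refine le_antisymm (fun v hv => ?_) hle
  have htop : v ∈ Submodule.span k (b '' {i | deg i = d}) ⊔
      Submodule.span k (b '' {i | deg i ≠ d}) := by
    rw [← Submodule.span_union, ← Set.image_union]
    have : {i | deg i = d} ∪ {i | deg i ≠ d} = Set.univ := by
      ext i; simp [em]
    rw [this, Set.image_univ, b.span_eq]
    trivial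
  obtain ⟨u, hu, u', hu', rfl⟩ := Submodule.mem_sup.1 htop
  have h1 : u' ∈ 𝒰 d := by simpa using Submodule.sub_mem _ hv (hle hu)
  have h2 : u' ∈ ⨆ e, ⨆ (_ : e ≠ d), 𝒰 e := by
    refine (Submodule.span_le.2 ?_ : Submodule.span k (b '' {i | deg i ≠ d}) ≤ _) hu'
    rintro _ ⟨i, hi, rfl⟩
    exact Submodule.mem_iSup_of_mem (deg i) (Submodule.mem_iSup_of_mem hi (hb i))
  have h0 : u' = 0 := Submodule.disjoint_def.1 (h.submodule_iSupIndep d) u' h1 h2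
  simpa [h0] using hu

theorem pow_apply_mem_of_map_mem {𝒰 : ℤ → Submodule k U} {f : Module.End k U}
    (hf : ∀ (d : ℤ) (v : U), v ∈ 𝒰 d → f v ∈ 𝒰 (d + 1)) {d : ℤ} {v : U} (hv : v ∈ 𝒰 d) (j : ℕ) :
    (f ^ j) v ∈ 𝒰 (d + j) := by
  induction j with
  | zero => simpa using hv
  | succ j ih =>
    rw [pow_succ', Module.End.mul_apply]
    simpa [add_assoc] using hf _ _ ih

end Grading

/-! ### Ranks determine the Jordan degree type -/

section Uniqueness

variable {k V : Type*} [Field k] [AddCommGroup V] [Module k V]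
  {𝒱 : ℤ → Submodule k V} {f : Module.End k V}

/-- The basis of `V` formed by the vectors of a string decomposition. -/
noncomputable def IsStringDecomposition.basis {r : ℕ} {len : Fin r → ℕ} {deg : Fin r → ℤ}
    {g : Fin r → V} (h : IsStringDecomposition 𝒱 f len deg g) :
    Module.Basis (Σ i : Fin r, Fin (len i)) k V :=
  Module.Basis.mk h.linearIndependent h.span_eq_top.ge

theorem IsStringDecomposition.basis_apply {r : ℕ} {len : Fin r → ℕ} {deg : Fin r → ℤ}
    {g : Fin r → V} (h : IsStringDecomposition 𝒱 f len deg g) (x : Σ i : Fin r, Fin (len i)) :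
    h.basis x = (f ^ (x.2 : ℕ)) (g x.1) := by
  simp [IsStringDecomposition.basis]

theorem IsStringDecomposition.pow_eq_zero {r : ℕ} {len : Fin r → ℕ} {deg : Fin r → ℤ}
    {g : Fin r → V} (h : IsStringDecomposition 𝒱 f len deg g) {i : Fin r} {j : ℕ}
    (hj : len i ≤ j) : (f ^ j) (g i) = 0 := by
  obtain ⟨e, rfl⟩ := Nat.exists_eq_add_of_le' hj
  rw [pow_add, Module.End.mul_apply, h.pow_len, map_zero]

/-- The rank of `f ^ j` on the degree `d` part is the number of strings that begin in degree at
most `d` and reach degree `d + j`. -/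
theorem IsStringDecomposition.finrank_map_pow (hf : IsGradedEnd 𝒱 f) {r : ℕ} {len : Fin r → ℕ}
    {deg : Fin r → ℤ} {g : Fin r → V} (h : IsStringDecomposition 𝒱 f len deg g) (d : ℤ) (j : ℕ) :
    Module.finrank k ((𝒱 d).map (f ^ j)) =
      ((Finset.univ : Finset (Fin r)).filter
        (fun i => deg i ≤ d ∧ d + j < deg i + len i)).card := by
  classical
  have hmem : ∀ x, h.basis x ∈ 𝒱 (deg x.1 + (x.2 : ℕ)) := fun x => by
    rw [h.basis_apply]
    exact pow_apply_mem_of_map_mem hf.map_mem (h.mem_deg x.1) _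
  let S := {i : Fin r // deg i ≤ d ∧ d + j < deg i + len i}
  -- `φ` picks the vector of degree `d + j` in string `i`.
  let φ : S → Σ i : Fin r, Fin (len i) := fun i =>
    ⟨i.1, ⟨(d + j - deg i.1).toNat, by have := i.2; omega⟩⟩
  have hφ : Function.Injective φ := fun i i' hi => Subtype.ext (congrArg Sigma.fst hi)
  have hspan : (𝒱 d).map (f ^ j) = Submodule.span k (Set.range (h.basis ∘ φ)) := by
    rw [eq_span_of_isInternal hf.isInternal h.basis hmem d, Submodule.map_span]
    apply le_antisymm
    · rw [Submodule.span_le]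
      rintro _ ⟨_, ⟨⟨i, q⟩, hq, rfl⟩, rfl⟩
      simp only [Set.mem_ofPred_eq] at hq
      rw [h.basis_apply, ← Module.End.mul_apply, ← pow_add]
      by_cases hlt : j + q < len i
      · refine Submodule.subset_span ⟨⟨i, by omega, by omega⟩, ?_⟩
        simp only [Function.comp_apply, h.basis_apply, φ]
        congr 2
        omega
      · rw [h.pow_eq_zero (not_lt.1 hlt)]
        exact Submodule.zero_mem _
    · rw [Submodule.span_le]
      rintro _ ⟨⟨i, h1, h2⟩, rfl⟩
      refine Submodule.subset_span
        ⟨_, ⟨⟨i, ⟨(d - deg i).toNat, by omega⟩⟩, ?_, rfl⟩, ?_⟩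
      · simp only [Set.mem_ofPred_eq]
        omega
      · simp only [Function.comp_apply, h.basis_apply, φ]
        rw [← Module.End.mul_apply, ← pow_add]
        congr 2
        omega
  rw [hspan, finrank_span_eq_card (h.basis.linearIndependent.comp φ hφ), Fintype.card_subtype]

/-- Inclusion–exclusion: among the strings covering degrees `e, …, e + L`, discard those also
covering `e - 1` or `e + L + 1`. -/
theorem Multiset.count_string_eq (P : Multiset (ℕ × ℤ)) (L : ℕ) (e : ℤ) :
    (P.count (L + 1, e) : ℤ) =
      P.countP (fun p => p.2 ≤ e ∧ e + (L : ℕ) < p.2 + p.1)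
        - P.countP (fun p => p.2 ≤ e - 1 ∧ e - 1 + ((L + 1 : ℕ) : ℤ) < p.2 + p.1)
        - P.countP (fun p => p.2 ≤ e ∧ e + ((L + 1 : ℕ) : ℤ) < p.2 + p.1)
        + P.countP (fun p => p.2 ≤ e - 1 ∧ e - 1 + ((L + 2 : ℕ) : ℤ) < p.2 + p.1) := by
  induction P using Multiset.induction_on with
  | empty => simp
  | cons p P ih =>
    obtain ⟨l, c⟩ := p
    simp only [Multiset.count_cons, Multiset.countP_cons, Prod.mk.injEq] at ih ⊢
    push_cast at ih ⊢
    rw [ih]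
    split_ifs <;> omega

theorem HasJordanDegreeType.countP_eq_finrank {P : Multiset (ℕ × ℤ)}
    (h : HasJordanDegreeType 𝒱 f P) (d : ℤ) (j : ℕ) :
    P.countP (fun p => p.2 ≤ d ∧ d + j < p.2 + p.1) = Module.finrank k ((𝒱 d).map (f ^ j)) := by
  obtain ⟨hf, r, len, deg, g, hg, rfl⟩ := h
  rw [hg.finrank_map_pow hf, Multiset.countP_map]
  rfl

theorem HasJordanDegreeType.unique {P Q : Multiset (ℕ × ℤ)}
    (hP : HasJordanDegreeType 𝒱 f P) (hQ : HasJordanDegreeType 𝒱 f Q) : P = Q := by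
  have hzero : ∀ {R : Multiset (ℕ × ℤ)} (e : ℤ), HasJordanDegreeType 𝒱 f R →
      R.count (0, e) = 0 := by
    rintro R e ⟨-, r, len, deg, g, hg, rfl⟩
    rw [Multiset.count_eq_zero]
    intro hmem
    obtain ⟨i, -, hi⟩ := Multiset.mem_map.1 hmem
    exact (hg.len_pos i).ne' (congrArg Prod.fst hi)
  ext ⟨L, e⟩
  cases L with
  | zero => rw [hzero e hP, hzero e hQ]
  | succ L =>
    zify
    rw [Multiset.count_string_eq, Multiset.count_string_eq]
    simp only [hP.countP_eq_finrank, hQ.countP_eq_finrank]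

end Uniqueness

/-! ### Independence and dimension count for strings -/

section Strings

variable {k U : Type*} [Field k] [AddCommGroup U] [Module k U]

/-- Strings are linearly independent as soon as their last vectors are. -/
theorem linearIndependent_strings {ι : Type*} [Fintype ι] (f : Module.End k U) (len : ι → ℕ)
    (g : ι → U) (hg : ∀ i, (f ^ len i) (g i) = 0)
    (hli : LinearIndependent k fun i => (f ^ (len i - 1)) (g i)) :
    LinearIndependent k (fun x : (Σ i, Fin (len i)) => (f ^ (x.2 : ℕ)) (g x.1)) := by
  classical
  rw [Fintype.linearIndependent_iff]
  intro c hc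
  have hzero : ∀ i j, len i ≤ j → (f ^ j) (g i) = 0 := fun i j hj => by
    obtain ⟨e, rfl⟩ := Nat.exists_eq_add_of_le' hj
    rw [pow_add, Module.End.mul_apply, hg, map_zero]
  obtain ⟨B, hB⟩ : ∃ B, ∀ i, len i ≤ B :=
    ⟨∑ i, len i, fun i => Finset.single_le_sum (fun _ _ => Nat.zero_le _) (Finset.mem_univ i)⟩
  -- Coefficients are killed in order of decreasing distance to the end of their string.
  suffices H : ∀ e : ℕ, ∀ x : (Σ i, Fin (len i)), B - e < len x.1 - x.2 → c x = 0 by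
    exact fun x => H B x (by have := x.2.2; omega)
  intro e
  induction e with
  | zero =>
    intro x hx
    have := hB x.1
    omega
  | succ e ih =>
    rintro ⟨i₀, j₀⟩ hx
    by_cases hlt : B - e < len i₀ - j₀
    · exact ih _ hlt
    simp only at hx
    set T := B - e with hT
    have hlen : len i₀ - j₀ = T := by omega
    have hT0 : 0 < T := by omega
    -- `f ^ (T - 1)` kills vectors with fewer than `T` steps left and sends those with exactly `T`
    -- to the ends of their strings; longer remainders already have coefficient zero.
    have hsum := congrArg (f ^ (T - 1)) hc
    rw [map_zero, map_sum, Fintype.sum_sigma] at hsum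
    have hterm : ∀ i, ∑ j : Fin (len i), (f ^ (T - 1)) (c ⟨i, j⟩ • (f ^ (j : ℕ)) (g i)) =
        (if h : T ≤ len i then c ⟨i, ⟨len i - T, by omega⟩⟩ else 0) •
          (f ^ (len i - 1)) (g i) := by
      intro i
      simp only [map_smul, ← Module.End.mul_apply, ← pow_add]
      split_ifs with h
      · rw [Finset.sum_eq_single ⟨len i - T, by omega⟩]
        · simp only
          congr 3
          omega
        · intro j _ hj
          have hj' : (j : ℕ) ≠ len i - T := fun hh => hj (Fin.ext hh)
          rcases lt_or_ge (j : ℕ) (len i - T) with h1 | h1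
          · rw [ih ⟨i, j⟩ (by simp only; omega), zero_smul]
          · rw [hzero _ _ (by omega), smul_zero]
        · simp
      · rw [zero_smul]
        refine Finset.sum_eq_zero fun j _ => ?_
        rw [hzero _ _ (by omega), smul_zero]
    simp only [hterm] at hsum
    have := Fintype.linearIndependent_iff.1 hli _ hsum i₀
    rw [dif_pos (by omega)] at this
    rw [← this]
    congr 2
    ext
    have := j₀.2
    simp only
    omega

theorem sum_fin_string_lengths (m n : ℕ) (hmn : m ≤ n) :
    ∑ i : Fin m, (n + m - 1 - 2 * (i : ℕ)) = m * n := by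
  have key : ∀ l ≤ m, ∑ i ∈ Finset.range l, (n + m - 1 - 2 * i) = l * (n + m - l) := by
    intro l
    induction l with
    | zero => simp
    | succ l ih =>
      intro hl
      rw [Finset.sum_range_succ, ih (by omega)]
      obtain ⟨q, rfl⟩ := Nat.exists_eq_add_of_le hl
      obtain ⟨q', rfl⟩ := Nat.exists_eq_add_of_le hmn
      have h1 : l + 1 + q + q' + (l + 1 + q) - l = l + 2 * q + q' + 2 := by omega
      have h2 : l + 1 + q + q' + (l + 1 + q) - (l + 1) = l + 2 * q + q' + 1 := by omega
      have h3 : l + 1 + q + q' + (l + 1 + q) - 1 - 2 * l = 2 * q + q' + 1 := by omega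
      rw [h1, h2, h3]
      ring
  rw [Fin.sum_univ_eq_sum_range (fun i => n + m - 1 - 2 * i), key m le_rfl, Nat.add_sub_cancel]

/-- A space of dimension `m * n` with a homogeneous vector in each of the degrees
`c, …, c + m - 1` that generates a string of the expected length has Jordan degree type
`(n + m - 1)_c, (n + m - 3)_(c + 1), …`. -/
theorem hasJordanDegreeType_of_generators {𝒰 : ℤ → Submodule k U} {f : Module.End k U}
    (hf : IsGradedEnd 𝒰 f) [Module.Finite k U] {m n : ℕ} (hmn : m ≤ n)
    (hdim : Module.finrank k U = m * n) (c : ℤ)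
    (hg : ∀ i < m, ∃ g ∈ 𝒰 (c + i), (f ^ (n + m - 1 - 2 * i)) g = 0 ∧
      (f ^ (n + m - 2 - 2 * i)) g ≠ 0) :
    HasJordanDegreeType 𝒰 f
      ((Finset.Icc 1 m).val.map (fun i => (n + m + 1 - 2 * i, c + (i : ℤ) - 1))) := by
  choose! g hdeg hzero hne using hg
  have hli := linearIndependent_strings f (fun i : Fin m => n + m - 1 - 2 * (i : ℕ))
    (fun i => g i) (fun i => hzero i i.2) (by
      -- String `i` ends in degree `c + n + m - 2 - i`: its start rises by `i` while its length
      -- drops by `2 * i`.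
      have hind := hf.isInternal.submodule_iSupIndep.comp
        (f := fun i : Fin m => c + n + m - 2 - (i : ℕ)) (fun i j hij => by
          simp only at hij
          ext
          omega)
      refine hind.linearIndependent _ (fun i => ?_) (fun i => ?_)
      · have h1 := pow_apply_mem_of_map_mem hf.map_mem (hdeg i i.2) (n + m - 1 - 2 * (i : ℕ) - 1)
        have h2 : c + (i : ℕ) + ((n + m - 1 - 2 * (i : ℕ) - 1 : ℕ) : ℤ) =
            c + n + m - 2 - (i : ℕ) := by omega
        rwa [h2] at h1
      · have h2 : n + m - 1 - 2 * (i : ℕ) - 1 = n + m - 2 - 2 * (i : ℕ) := by omega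
        rw [h2]
        exact hne i i.2)
  refine ⟨hf, m, fun i => n + m - 1 - 2 * (i : ℕ), fun i => c + (i : ℕ), fun i => g i,
    ⟨fun i => by omega, fun i => hdeg i i.2, fun i => hzero i i.2, hli, ?_⟩, ?_⟩
  · refine hli.span_eq_top_of_card_eq_finrank' ?_
    rw [Fintype.card_sigma, hdim]
    simpa using sum_fin_string_lengths m n hmn
  · have hIcc : (Finset.Icc 1 m).val =
        (Finset.univ : Finset (Fin m)).val.map (fun i : Fin m => (i : ℕ) + 1) := by
      have hinj : Function.Injective fun i : Fin m => (i : ℕ) + 1 :=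
        fun i j h => Fin.ext (Nat.succ.inj h)
      have : Finset.Icc 1 m = (Finset.univ : Finset (Fin m)).map
          ⟨fun i : Fin m => (i : ℕ) + 1, hinj⟩ := by
        ext l
        simp only [Finset.mem_Icc, Finset.mem_map, Finset.mem_univ, true_and,
          Function.Embedding.coeFn_mk]
        exact ⟨fun h => ⟨⟨l - 1, by omega⟩, by simp only; omega⟩, by rintro ⟨i, rfl⟩; omega⟩
      rw [this]
      rfl
    rw [hIcc, Multiset.map_map]
    refine Multiset.map_congr rfl fun i _ => ?_
    simp only [Function.comp_apply, Prod.mk.injEq]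
    push_cast
    constructor <;> omega

end Strings

/-! ### Grading and operator on the tensor product -/

section Tensor

open TensorProduct

variable {k V W : Type*} [Field k] [AddCommGroup V] [Module k V] [AddCommGroup W] [Module k W]

/-- A graded module that is a single string has a basis `v, f v, f ^ 2 v, …`, and so it does after
rescaling `f` by a nonzero scalar. -/
theorem HasJordanDegreeType.exists_string_basis {𝒱 : ℤ → Submodule k V} {f : Module.End k V}
    {m : ℕ} {s : ℤ} (h : HasJordanDegreeType 𝒱 f {(m, s)}) {a : k} (ha : a ≠ 0) :
    ∃ (v : V) (b : Module.Basis (Fin m) k V), v ∈ 𝒱 s ∧ (∀ p, b p = ((a • f) ^ (p : ℕ)) v) ∧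
      ((a • f) ^ m) v = 0 := by
  obtain ⟨hf, r, len, deg, g, hg, hP⟩ := h
  have hr : r = 1 := by simpa using (congrArg Multiset.card hP).symm
  subst hr
  have h0 : (m, s) = (len 0, deg 0) := by simpa using hP
  obtain ⟨rfl, rfl⟩ := Prod.mk.inj h0
  let e : (Σ i : Fin 1, Fin (len i)) ≃ Fin (len 0) :=
    Equiv.uniqueSigma (fun i : Fin 1 => Fin (len i))
  refine ⟨g 0, (hg.basis.reindex e).unitsSMul (fun p => (Units.mk0 a ha) ^ (p : ℕ)),
    hg.mem_deg 0, fun p => ?_, ?_⟩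
  · have he : e.symm p = ⟨0, p⟩ := e.symm_apply_eq.2 rfl
    rw [Module.Basis.unitsSMul_apply, Module.Basis.reindex_apply, he, hg.basis_apply, smul_pow,
      LinearMap.smul_apply]
    simp [Units.smul_def]
  · rw [smul_pow, LinearMap.smul_apply, hg.pow_len, smul_zero]

theorem tensorEnd_eq_smul (a b : k) (f : Module.End k V) (g : Module.End k W) :
    tensorEnd a b f g = tensorEnd 1 1 (a • f) (b • g) := by
  simp only [tensorEnd, TensorProduct.map_smul_left, TensorProduct.map_smul_right, one_smul]

theorem tensorEnd_one_tmul (f : Module.End k V) (g : Module.End k W) (v : V) (w : W) :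
    tensorEnd 1 1 f g (v ⊗ₜ[k] w) = f v ⊗ₜ[k] w + v ⊗ₜ[k] g w := by
  simp [tensorEnd]

theorem tmul_mem_tensorGrading {𝒱 : ℤ → Submodule k V} {𝒲 : ℤ → Submodule k W} {i j : ℤ} {v : V}
    {w : W} (hv : v ∈ 𝒱 i) (hw : w ∈ 𝒲 j) : v ⊗ₜ[k] w ∈ tensorGrading 𝒱 𝒲 (i + j) :=
  Submodule.subset_span ⟨i, j, v, w, rfl, hv, hw, rfl⟩

theorem tensorGrading_eq_span {ι κ : Type*} {𝒱 : ℤ → Submodule k V} {𝒲 : ℤ → Submodule k W}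
    (h𝒱 : DirectSum.IsInternal 𝒱) (h𝒲 : DirectSum.IsInternal 𝒲) (b : Module.Basis ι k V)
    (c : Module.Basis κ k W) {deg : ι → ℤ} {deg' : κ → ℤ} (hb : ∀ i, b i ∈ 𝒱 (deg i))
    (hc : ∀ i, c i ∈ 𝒲 (deg' i)) (d : ℤ) :
    tensorGrading 𝒱 𝒲 d =
      Submodule.span k (b.tensorProduct c '' {p | deg p.1 + deg' p.2 = d}) := by
  apply le_antisymm
  · refine Submodule.span_le.2 ?_
    rintro _ ⟨i, j, v, w, rfl, hv, hw, rfl⟩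
    rw [eq_span_of_isInternal h𝒱 b hb i] at hv
    rw [eq_span_of_isInternal h𝒲 c hc j] at hw
    have := Submodule.apply_mem_map₂ (TensorProduct.mk k V W) hv hw
    rw [Submodule.map₂_span_span] at this
    refine Submodule.span_mono ?_ this
    rintro _ ⟨_, ⟨p, rfl, rfl⟩, _, ⟨q, rfl, rfl⟩, rfl⟩
    exact ⟨(p, q), rfl, by simp⟩
  · refine Submodule.span_le.2 ?_
    rintro _ ⟨⟨p, q⟩, rfl, rfl⟩
    rw [Module.Basis.tensorProduct_apply]
    exact tmul_mem_tensorGrading (hb p) (hc q)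

theorem isGradedEnd_tensor {ι κ : Type*} {𝒱 : ℤ → Submodule k V} {𝒲 : ℤ → Submodule k W}
    {f : Module.End k V} {g : Module.End k W} (hf : IsGradedEnd 𝒱 f) (hg : IsGradedEnd 𝒲 g)
    (b : Module.Basis ι k V) (c : Module.Basis κ k W) {deg : ι → ℤ} {deg' : κ → ℤ}
    (hb : ∀ i, b i ∈ 𝒱 (deg i)) (hc : ∀ i, c i ∈ 𝒲 (deg' i)) :
    IsGradedEnd (tensorGrading 𝒱 𝒲) (tensorEnd 1 1 f g) := by
  refine ⟨?_, fun d u hu => ?_⟩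
  · rw [show tensorGrading 𝒱 𝒲 = _ from
      funext (tensorGrading_eq_span hf.isInternal hg.isInternal b c hb hc)]
    exact isInternal_span_basis _ _
  · refine (Submodule.span_le.2 ?_ : tensorGrading 𝒱 𝒲 d ≤
      (tensorGrading 𝒱 𝒲 (d + 1)).comap (tensorEnd 1 1 f g)) hu
    rintro _ ⟨i, j, v, w, rfl, hv, hw, rfl⟩
    rw [SetLike.mem_coe, Submodule.mem_comap, tensorEnd_one_tmul]
    refine Submodule.add_mem _ ?_ ?_
    · rw [add_right_comm]
      exact tmul_mem_tensorGrading (hf.map_mem _ _ hv) hw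
    · rw [add_assoc]
      exact tmul_mem_tensorGrading hv (hg.map_mem _ _ hw)

end Tensor

/-! ### Lowering operators and primitive vectors -/

section LoweringOperator

open TensorProduct

variable {k V W : Type*} [Field k] [AddCommGroup V] [Module k V] [AddCommGroup W] [Module k W]

/-- The lowering operator of the irreducible representation of `sl₂` of dimension `m`, in the
basis in which the raising operator is a Jordan block. -/
theorem exists_lowering {m : ℕ} {f : Module.End k V} {v : V} (b : Module.Basis (Fin m) k V)
    (hb : ∀ p, b p = (f ^ (p : ℕ)) v) :
    -- Both sides vanish at `p = m`, which the commutator needs at the top vector; at `p = 0` the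
    -- truncated exponent is harmless.
    ∃ F : Module.End k V, ∀ p ≤ m, (f ^ m) v = 0 →
      F ((f ^ p) v) = ((p : k) * (m - p)) • (f ^ (p - 1)) v := by
  refine ⟨b.constr k fun p => (((p : ℕ) : k) * (m - (p : ℕ))) • (f ^ ((p : ℕ) - 1)) v,
    fun p hp h0 => ?_⟩
  rcases hp.lt_or_eq with hlt | rfl
  · have := b.constr_basis k
      (fun p => (((p : ℕ) : k) * (m - (p : ℕ))) • (f ^ ((p : ℕ) - 1)) v) ⟨p, hlt⟩
    rwa [hb] at this
  · simp [h0]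

theorem lowering_commutator {m : ℕ} {f F : Module.End k V} {v : V}
    (hF : ∀ p ≤ m, F ((f ^ p) v) = ((p : k) * (m - p)) • (f ^ (p - 1)) v) {p : ℕ} (hp : p < m) :
    F (f ((f ^ p) v)) - f (F ((f ^ p) v)) = ((m : k) - 1 - 2 * p) • (f ^ p) v := by
  rw [← Module.End.mul_apply f, ← pow_succ', hF (p + 1) hp, hF p hp.le, map_smul,
    ← Module.End.mul_apply, ← pow_succ', Nat.add_sub_cancel]
  rcases p with _ | p
  · simp
  · rw [Nat.add_sub_cancel, ← sub_smul]
    congr 1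
    push_cast
    ring

/-- The commutators accumulate: the sum of `μ - 2r` over `r ≤ j` is `(j + 1)(μ - j)`. -/
theorem lowering_pow_of_commutator {E F : Module.End k V} {v : V} {μ : k} (h0 : F v = 0)
    (hc : ∀ j : ℕ, F (E ((E ^ j) v)) - E (F ((E ^ j) v)) = (μ - 2 * j) • (E ^ j) v) (j : ℕ) :
    F ((E ^ (j + 1)) v) = (((j + 1 : ℕ) : k) * (μ - j)) • (E ^ j) v := by
  induction j with
  | zero =>
    have := hc 0
    simp only [pow_zero, Module.End.one_apply, h0, map_zero, sub_zero] at this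
    simpa using this
  | succ j ih =>
    have := hc (j + 1)
    rw [ih, map_smul, ← Module.End.mul_apply E, ← Module.End.mul_apply E, ← pow_succ',
      ← pow_succ', sub_eq_iff_eq_add, ← add_smul] at this
    rw [this]
    congr 1
    push_cast
    ring

/-- The coefficients of the primitive vector of degree `i`. -/
def primitiveCoeff (m n i j : ℕ) : ℤ :=
  (-1) ^ j * (i.choose j * (m - 1 - j).factorial * (n - 1 - i + j).factorial : ℕ)

/-- This is the vanishing of the coefficient of `x^j v ⊗ y^(i-j-1) w` in `F g`. The factorials clear
denominators, so it holds over `ℤ` and casts to any field. -/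
theorem primitiveCoeff_succ {m n i j : ℕ} (hj : j < i) (him : i < m) (hin : i < n) :
    primitiveCoeff m n i (j + 1) * ((j + 1 : ℕ) * (m - (j + 1 : ℕ))) +
      primitiveCoeff m n i j * ((i - j : ℕ) * (n - (i - j : ℕ))) = 0 := by
  obtain ⟨q, rfl⟩ := Nat.exists_eq_add_of_lt hj
  obtain ⟨m', rfl⟩ := Nat.exists_eq_add_of_lt him
  obtain ⟨n', rfl⟩ := Nat.exists_eq_add_of_lt hin
  have h1 : j + q + 1 + m' + 1 - 1 - (j + 1) = q + m' := by omega
  have h2 : j + q + 1 + m' + 1 - 1 - j = q + m' + 1 := by omega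
  have h3 : j + q + 1 + n' + 1 - 1 - (j + q + 1) = n' := by omega
  have h4 : j + q + 1 - j = q + 1 := by omega
  have hch : ((j + q + 1).choose (j + 1) : ℤ) * (j + 1) = (j + q + 1).choose j * (q + 1) := by
    have := Nat.choose_succ_right_eq (j + q + 1) j
    rw [h4] at this
    exact_mod_cast this
  simp only [primitiveCoeff, h1, h2, h3, h4, ← add_assoc n', Nat.factorial_succ]
  push_cast
  linear_combination (-1 : ℤ) ^ (j + 1) * (q + m').factorial * ((n' + j + 1) *
    (n' + j).factorial) * (q + m' + 1) * hch

theorem natCast_factorial_ne_zero {N : ℕ} (hN : ∀ l, 1 ≤ l → l ≤ N → (l : k) ≠ 0) {l : ℕ}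
    (hl : l ≤ N) : (l.factorial : k) ≠ 0 := by
  induction l with
  | zero => simp
  | succ l ih =>
    rw [Nat.factorial_succ, Nat.cast_mul]
    exact mul_ne_zero (hN _ (by omega) hl) (ih (by omega))

/-- Each of the degrees below `m` of the tensor product of two strings of lengths `m ≤ n` has a
vector that generates a string of the expected length. -/
theorem exists_generator_tensor {m n : ℕ} (hmn : m ≤ n)
    (hN : ∀ l : ℕ, 1 ≤ l → l ≤ n + m - 2 → (l : k) ≠ 0) {s t : ℤ}
    {𝒱 : ℤ → Submodule k V} {𝒲 : ℤ → Submodule k W} {x : Module.End k V} {y : Module.End k W}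
    (hx : IsGradedEnd 𝒱 x) (hy : IsGradedEnd 𝒲 y) {v : V} {w : W} (hv : v ∈ 𝒱 s) (hw : w ∈ 𝒲 t)
    (b : Module.Basis (Fin m) k V) (hb : ∀ p, b p = (x ^ (p : ℕ)) v) (hx0 : (x ^ m) v = 0)
    (c : Module.Basis (Fin n) k W) (hc : ∀ p, c p = (y ^ (p : ℕ)) w) (hy0 : (y ^ n) w = 0)
    {i : ℕ} (hi : i < m) :
    ∃ g ∈ tensorGrading 𝒱 𝒲 (s + t + i),
      (tensorEnd 1 1 x y ^ (n + m - 1 - 2 * i)) g = 0 ∧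
      (tensorEnd 1 1 x y ^ (n + m - 2 - 2 * i)) g ≠ 0 := by
  classical
  have hbdeg : ∀ p : Fin m, b p ∈ 𝒱 (s + (p : ℕ)) := fun p => by
    rw [hb]; exact pow_apply_mem_of_map_mem hx.map_mem hv _
  have hcdeg : ∀ p : Fin n, c p ∈ 𝒲 (t + (p : ℕ)) := fun p => by
    rw [hc]; exact pow_apply_mem_of_map_mem hy.map_mem hw _
  have hspan := tensorGrading_eq_span hx.isInternal hy.isInternal b c hbdeg hcdeg
  have hE := isGradedEnd_tensor hx hy b c hbdeg hcdeg
  obtain ⟨F₁, hF₁⟩ := exists_lowering b hb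
  obtain ⟨F₂, hF₂⟩ := exists_lowering c hc
  replace hF₁ := fun p hp => hF₁ p hp hx0
  replace hF₂ := fun p hp => hF₂ p hp hy0
  set E := tensorEnd 1 1 x y with hEdef
  set F := tensorEnd 1 1 F₁ F₂ with hFdef
  have hcomm : ∀ (d : ℕ), ∀ u ∈ tensorGrading 𝒱 𝒲 (s + t + d),
      F (E u) - E (F u) = ((n + m - 2 : ℕ) - 2 * d : k) • u := by
    intro d u hu
    rw [hspan] at hu
    induction hu using Submodule.span_induction with
    | mem u hu =>
      obtain ⟨⟨p, q⟩, hpq, rfl⟩ := hu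
      simp only [Set.mem_ofPred_eq] at hpq
      obtain rfl : (p : ℕ) + q = d := by omega
      have h1 := lowering_commutator hF₁ p.2
      have h2 := lowering_commutator hF₂ q.2
      have hcast : ((n + m - 2 : ℕ) : k) = n + m - 2 := by
        rw [Nat.cast_sub (by omega)]; push_cast; ring
      rw [Module.Basis.tensorProduct_apply, hb, hc]
      generalize hv' : (x ^ (p : ℕ)) v = v' at h1 ⊢
      generalize hw' : (y ^ (q : ℕ)) w = w' at h2 ⊢
      have : F (E (v' ⊗ₜ[k] w')) - E (F (v' ⊗ₜ[k] w')) =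
          (F₁ (x v') - x (F₁ v')) ⊗ₜ[k] w' + v' ⊗ₜ[k] (F₂ (y w') - y (F₂ w')) := by
        simp only [hEdef, hFdef, tensorEnd_one_tmul, map_add, TensorProduct.sub_tmul,
          TensorProduct.tmul_sub]
        abel
      rw [this, h1, h2, TensorProduct.tmul_smul, ← TensorProduct.smul_tmul', ← add_smul, hcast]
      congr 1
      push_cast
      ring
    | zero => simp
    | add u u' _ _ h h' =>
      simp only [map_add, smul_add, ← h, ← h']
      abel
    | smul r u _ h =>
      simp only [map_smul, ← smul_sub, h]
      rw [smul_comm]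
  let e : ℕ → V ⊗[k] W := fun j => ((x ^ j) v) ⊗ₜ[k] ((y ^ (i - j)) w)
  let g : V ⊗[k] W := ∑ j ∈ Finset.range (i + 1), (primitiveCoeff m n i j : k) • e j
  have hgdeg : g ∈ tensorGrading 𝒱 𝒲 (s + t + i) := by
    refine Submodule.sum_mem _ fun j hj => Submodule.smul_mem _ _ ?_
    have := tmul_mem_tensorGrading (pow_apply_mem_of_map_mem hx.map_mem hv j)
      (pow_apply_mem_of_map_mem hy.map_mem hw (i - j))
    rw [Finset.mem_range] at hj
    have h2 : s + j + (t + (i - j : ℕ)) = s + t + i := by omega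
    rwa [h2] at this
  have hFg : F g = 0 := by
    have hFe : ∀ j ∈ Finset.range (i + 1), F ((primitiveCoeff m n i j : k) • e j) =
        ((primitiveCoeff m n i j : k) * (j * (m - j))) •
          (((x ^ (j - 1)) v) ⊗ₜ[k] ((y ^ (i - j)) w)) +
        ((primitiveCoeff m n i j : k) * ((i - j : ℕ) * (n - (i - j : ℕ)))) •
          (((x ^ j) v) ⊗ₜ[k] ((y ^ (i - j - 1)) w)) := fun j hj => by
      rw [Finset.mem_range] at hj
      simp only [e]
      rw [map_smul, hFdef, tensorEnd_one_tmul, hF₁ j (by omega), hF₂ (i - j) (by omega),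
        TensorProduct.tmul_smul, ← TensorProduct.smul_tmul', smul_add, smul_smul, smul_smul]
    simp only [g]
    -- The boundary terms carry a zero factor; after shifting the first sum, the rest cancel in
    -- pairs.
    rw [map_sum, Finset.sum_congr rfl hFe, Finset.sum_add_distrib, Finset.sum_range_succ',
      Finset.sum_range_succ _ i]
    simp only [Nat.cast_zero, zero_mul, mul_zero, zero_smul, add_zero, Nat.sub_self]
    rw [← Finset.sum_add_distrib]
    refine Finset.sum_eq_zero fun j hj => ?_
    rw [Finset.mem_range] at hj
    rw [Nat.add_sub_cancel, Nat.sub_sub, ← add_smul]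
    have := congrArg (Int.cast : ℤ → k) (primitiveCoeff_succ (n := n) hj hi (by omega))
    push_cast at this ⊢
    rw [this, zero_smul]
  -- The coefficient of `v ⊗ y^i w` in `g` is `(m-1)! (n-1-i)!`.
  have hg0 : g ≠ 0 := by
    intro hg
    have hrepr := congrArg (fun u =>
      (b.tensorProduct c).repr u (⟨0, by omega⟩, ⟨i, by omega⟩)) hg
    have he : ∀ j ∈ Finset.range (i + 1),
        (b.tensorProduct c).repr (e j) (⟨0, by omega⟩, ⟨i, by omega⟩) =
          if j = 0 then 1 else 0 := fun j hj => by
      rw [Finset.mem_range] at hj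
      have : e j = b.tensorProduct c (⟨j, by omega⟩, ⟨i - j, by omega⟩) := by
        rw [Module.Basis.tensorProduct_apply, hb, hc]
      rw [this, Module.Basis.repr_self, Finsupp.single_apply]
      refine if_congr ?_ rfl rfl
      simp only [Prod.mk.injEq, Fin.mk.injEq]
      omega
    simp only [g, map_sum, map_smul, Finsupp.coe_finsetSum, Finset.sum_apply, map_zero,
      Finsupp.coe_zero, Pi.zero_apply, Finsupp.coe_smul, Pi.smul_apply, smul_eq_mul] at hrepr
    rw [Finset.sum_congr rfl fun j hj => by rw [he j hj]] at hrepr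
    simp only [mul_ite, mul_one, mul_zero, Finset.sum_ite_eq', Finset.mem_range,
      Nat.succ_pos, if_true] at hrepr
    simp only [primitiveCoeff, pow_zero, one_mul, Nat.choose_zero_right, Int.cast_natCast,
      Int.cast_mul, Nat.cast_mul] at hrepr
    exact mul_ne_zero (natCast_factorial_ne_zero hN (l := m - 1 - 0) (by omega))
      (natCast_factorial_ne_zero hN (l := n - 1 - i + 0) (by omega)) hrepr
  have hlow := lowering_pow_of_commutator (μ := ((n + m - 2 : ℕ) : k) - 2 * i) hFg (E := E)
    fun j => by
      have h1 := pow_apply_mem_of_map_mem hE.map_mem hgdeg j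
      rw [add_assoc, ← Nat.cast_add] at h1
      rw [hcomm _ _ h1]
      congr 1
      push_cast
      ring
  -- Nothing lives above degree `s + t + n + m - 2`.
  have hnil : (E ^ (n + m - 1 - i)) g = 0 := by
    have h1 := pow_apply_mem_of_map_mem hE.map_mem hgdeg (n + m - 1 - i)
    rw [hspan] at h1
    have hempty : {p : Fin m × Fin n | s + ((p.1 : ℕ) : ℤ) + (t + ((p.2 : ℕ) : ℤ)) =
        s + t + i + (n + m - 1 - i : ℕ)} = ∅ := by
      ext p
      simp only [Set.mem_ofPred_eq, Set.mem_empty_iff_false, iff_false]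
      omega
    rw [hempty] at h1
    simpa using h1
  have hex : ∃ l, (E ^ l) g = 0 := ⟨_, hnil⟩
  have hle := Nat.find_min' hex hnil
  have hspec := Nat.find_spec hex
  have hmin : ∀ l < Nat.find hex, (E ^ l) g ≠ 0 := fun l hl => Nat.find_min hex hl
  generalize Nat.find hex = l at hle hspec hmin
  obtain ⟨l, rfl⟩ : ∃ l', l = l' + 1 := by
    cases l with
    | zero => exact absurd hspec hg0
    | succ l => exact ⟨l, rfl⟩
  have hprod := hlow l
  rw [hspec, map_zero] at hprod
  replace hprod := (smul_eq_zero.1 hprod.symm).resolve_right (hmin l l.lt_succ_self)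
  have hl : l = n + m - 2 - 2 * i := by
    -- If `l + 1` vanishes in `k`, then `l + 1 ≥ n + m - 1`; with `l + 1 ≤ n + m - 1 - i` this
    -- leaves only `i = 0`, where the claim holds.
    rcases mul_eq_zero.1 hprod with h | h
    · by_contra hne
      exact hN (l + 1) (by omega) (by omega) h
    · have h' : ((n + m - 2 : ℕ) : k) = ((2 * i + l : ℕ) : k) := by
        push_cast
        linear_combination h
      rcases lt_trichotomy (n + m - 2) (2 * i + l) with hlt | heq | hgt
      · refine absurd ?_ (hN (2 * i + l - (n + m - 2)) (by omega) (by omega))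
        rw [Nat.cast_sub hlt.le, h', sub_self]
      · omega
      · refine absurd ?_ (hN (n + m - 2 - (2 * i + l)) (by omega) (by omega))
        rw [Nat.cast_sub hgt.le, h', sub_self]
  refine ⟨g, hgdeg, ?_, ?_⟩
  · rwa [show n + m - 1 - 2 * i = l + 1 by omega]
  · rw [← hl]
    exact hmin l l.lt_succ_self

end LoweringOperator

theorem corollary3p8 {k V W : Type*} [Field k] [AddCommGroup V] [Module k V]
    [AddCommGroup W] [Module k W]
    (m n : ℕ) (hm : 1 ≤ m) (hmn : m ≤ n)
    (hchar : ringChar k = 0 ∨ m + n - 2 ≤ ringChar k)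
    (hstrict : 2 ≤ m → ringChar k ≠ m + n - 2)
    (s t : ℤ)
    (𝒱 : ℤ → Submodule k V) (x : Module.End k V) (hV : HasJordanDegreeType 𝒱 x {(m, s)})
    (𝒲 : ℤ → Submodule k W) (y : Module.End k W) (hW : HasJordanDegreeType 𝒲 y {(n, t)})
    (a b : k) (ha : a ≠ 0) (hb : b ≠ 0) (P : Multiset (ℕ × ℤ)) :
    HasJordanDegreeType (tensorGrading 𝒱 𝒲) (tensorEnd a b x y) P ↔
      P = (Finset.Icc 1 m).val.map (fun i => (n + m + 1 - 2 * i, s + t + (i : ℤ) - 1)) := by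
  suffices H : HasJordanDegreeType (tensorGrading 𝒱 𝒲) (tensorEnd a b x y)
      ((Finset.Icc 1 m).val.map (fun i => (n + m + 1 - 2 * i, s + t + (i : ℤ) - 1))) from
    ⟨fun h => h.unique H, fun h => h ▸ H⟩
  obtain ⟨v, B, hv, hB, hx0⟩ := hV.exists_string_basis ha
  obtain ⟨w, C, hw, hC, hy0⟩ := hW.exists_string_basis hb
  have hX : IsGradedEnd 𝒱 (a • x) :=
    ⟨hV.1.isInternal, fun d u hu => Submodule.smul_mem _ _ (hV.1.map_mem d u hu)⟩
  have hY : IsGradedEnd 𝒲 (b • y) :=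
    ⟨hW.1.isInternal, fun d u hu => Submodule.smul_mem _ _ (hW.1.map_mem d u hu)⟩
  rw [tensorEnd_eq_smul]
  generalize a • x = X at *
  generalize b • y = Y at *
  have hE : IsGradedEnd (tensorGrading 𝒱 𝒲) (tensorEnd 1 1 X Y) :=
    isGradedEnd_tensor hX hY B C (deg := fun p => s + (p : ℕ)) (deg' := fun p => t + (p : ℕ))
      (fun p => by rw [hB]; exact pow_apply_mem_of_map_mem hX.map_mem hv _)
      (fun p => by rw [hC]; exact pow_apply_mem_of_map_mem hY.map_mem hw _)
  have : Module.Finite k (TensorProduct k V W) := .of_basis (B.tensorProduct C)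
  refine hasJordanDegreeType_of_generators hE hmn
    (by simp [Module.finrank_eq_card_basis (B.tensorProduct C)]) (s + t) fun i hi => ?_
  -- For `m = 1` the characteristic may equal `n - 1`, so the `sl₂` argument is unavailable; but `X
  -- v = 0`, and `v ⊗ w` generates everything.
  rcases hm.eq_or_lt with rfl | hm2
  · obtain rfl : i = 0 := by omega
    have hXv : X v = 0 := by simpa using hx0
    have hpow : ∀ j : ℕ, (tensorEnd 1 1 X Y ^ j) (v ⊗ₜ[k] w) = v ⊗ₜ[k] (Y ^ j) w := by
      intro j
      induction j with
      | zero => simp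
      | succ j ih =>
        rw [pow_succ', Module.End.mul_apply, ih, tensorEnd_one_tmul, hXv, TensorProduct.zero_tmul,
          zero_add, pow_succ' Y, Module.End.mul_apply]
    refine ⟨v ⊗ₜ[k] w, by simpa using tmul_mem_tensorGrading hv hw, ?_, ?_⟩
    · rw [hpow]
      simp [hy0]
    · have hne := (B.tensorProduct C).ne_zero (⟨0, by omega⟩, ⟨n - 1, by omega⟩)
      rw [Module.Basis.tensorProduct_apply, hB, hC] at hne
      rw [hpow]
      simpa using hne
  · refine exists_generator_tensor hmn (fun l h1 h2 h0 => ?_) hX hY hv hw B hB hx0 C hC hy0 hi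
    have hdvd := ringChar.dvd h0
    have hs := hstrict hm2
    rcases hchar with h | h
    · rw [h, zero_dvd_iff] at hdvd
      omega
    · have := Nat.le_of_dvd h1 hdvd
      omega
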